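/- A network is a finite directed acyclic multigraph in which each of finitely many messages is generated at one of the nodes and each node demands a (possibly empty) set of messages. The inputs of a node are the messages generated at it and the symbols carried by its incoming edges. A code over an alphabet $A$ assigns to every edge a function from the inputs of its tail to $A$, which computes the symbol carried by the edge, and to every node and every message demanded there a decoding function from the inputs of the node to $A$; it is a solution if, for all values of the messages in $A$, each decoding function returns the demanded message. All rings are associative with identity, not necessarily commutative. For a ring $S$ and a left $S$-module $G$, a linear solution over $G$ is a solution over the alphabet $G$ all of whose edge and decoding functions have the form $(x_1,\dots,x_n)\mapsto c_1\cdot x_1+\cdots+c_n\cdot x_n$ with constants $c_1,\dots,c_n\in S$. A scalar linear solution over a ring $R$ is a linear solution over $R$ as a left module over itself, and a $k$-dimensional vector linear solution over $R$ is a linear solution over $R^k$ as a module over the ring of $k\times k$ matrices over $R$, acting by matrix-vector multiplication. Theorem. Let $m=p_1^{k_1}\cdots p_t^{k_t}$, where $p_1,\dots,p_t$ are distinct primes and $k_1,\dots,k_t$ are positive integers. If a network has a scalar linear solution over some ring of size $m$, then for each $i\in\{1,\dots,t\}$ with $k_i\le 6$ the network has a $k_i$-dimensional vector linear solution over the field $\mathrm{GF}(p_i)$.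 -/

import Mathlib

/-- A network: a finite, directed, acyclic multigraph with nodes `V` and edges `E`,
each message in `M` being generated at a (source) node, and each node `v` demanding a set
`demands v` of messages (the receivers are the nodes that demand at least one message).
Parallel edges are allowed.  Finiteness of `V`, `E`, `M` is required wherever codes are used. -/
structure Network (V E M : Type*) where
  tail : E → V
  head : E → V
  source : M → V
  demands : V → Set M
  acyclic : ∀ v : V, ¬ Relation.TransGen (fun u w => ∃ e : E, tail e = u ∧ head e = w) v v

namespace Network

variable {V E M : Type*}

/-- The inputs of a node: the messages generated at the node, and its in-edges. -/
def Inputs (N : Network V E M) (v : V) : Type _ :=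
  {m : M // N.source m = v} ⊕ {e : E // N.head e = v}

noncomputable instance [Finite E] [Finite M] (N : Network V E M) (v : V) :
    Fintype (N.Inputs v) :=
  letI : Finite (N.Inputs v) := inferInstanceAs (Finite (_ ⊕ _))
  Fintype.ofFinite _

/-- The symbols at the inputs of the node `v`, when the messages have the values `x` and the edges
carry the symbols `y`. -/
def inputSymbols (N : Network V E M) {A : Type*} (x : M → A) (y : E → A) (v : V) :
    N.Inputs v → A :=
  Sum.elim (fun m => x m.1) (fun e => y e.1)

/-- A code over the alphabet `A`: an edge function for every edge, applied to the inputs of the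
tail of the edge, and a decoding function for every node and every message it demands. -/
structure Code (N : Network V E M) (A : Type*) where
  edgeFn : ∀ e : E, (N.Inputs (N.tail e) → A) → A
  decodeFn : ∀ v : V, ∀ m ∈ N.demands v, (N.Inputs v → A) → A

namespace Code

variable {N : Network V E M} {A : Type*}

/-- Given the messages `x`, the edges carry the symbols `y`. -/
def Carries (C : N.Code A) (x : M → A) (y : E → A) : Prop :=
  ∀ e, y e = C.edgeFn e (N.inputSymbols x y (N.tail e))

/-- Since the network is acyclic, the messages determine the edge symbols. -/
theorem existsUnique_carries [Finite V] (C : N.Code A) (x : M → A) : ∃! y, C.Carries x y := by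
  let r : V → V → Prop := Relation.TransGen (fun u w => ∃ e : E, N.tail e = u ∧ N.head e = w)
  have : IsTrans V r := ⟨fun _ _ _ => Relation.TransGen.trans⟩
  have : Std.Irrefl r := ⟨N.acyclic⟩
  have wf : WellFounded r := Finite.wellFounded_of_trans_of_irrefl r
  have wfE : WellFounded (InvImage r N.tail) := InvImage.wf _ wf
  have key : ∀ e (e' : {e' : E // N.head e' = N.tail e}), InvImage r N.tail e'.1 e :=
    fun e e' => Relation.TransGen.single ⟨e'.1, rfl, e'.2⟩
  let F : ∀ e : E, (∀ e', InvImage r N.tail e' e → A) → A := fun e ih =>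
    C.edgeFn e (Sum.elim (fun m => x m.1) (fun e' => ih e'.1 (key e e')))
  refine ⟨wfE.fix F, fun e => ?_, fun y hy => ?_⟩
  · rw [wfE.fix_eq]
    rfl
  · funext e
    induction e using wfE.induction with
    | h e ih =>
      rw [hy e, wfE.fix_eq]
      refine congrArg (C.edgeFn e) (funext fun i => ?_)
      rcases i with m | e'
      · rfl
      · exact ih e'.1 (key e e')

/-- A code is a solution if, whatever the messages are, every decoding function applied to the
symbols received returns the demanded message. -/
def IsSolution (C : N.Code A) : Prop :=
  ∀ x : M → A, ∃ y : E → A, C.Carries x y ∧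
    ∀ (v : V) (m : M) (hm : m ∈ N.demands v), C.decodeFn v m hm (N.inputSymbols x y v) = x m

end Code

/-- A function `f` of finitely many inputs in `G` is linear over the left `R`-module `G` if
`f (x₁, …, xₙ) = c₁ • x₁ + ⋯ + cₙ • xₙ` for constants `c₁, …, cₙ` in `R`. -/
def IsLinearFn (R : Type*) {G ι : Type*} [Ring R] [AddCommGroup G] [Module R G] [Fintype ι]
    (f : (ι → G) → G) : Prop :=
  ∃ c : ι → R, ∀ x : ι → G, f x = ∑ i, c i • x i

/-- All edge functions and decoding functions are linear over the `R`-module `G`. -/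
def Code.IsLinear (R : Type*) {G : Type*} [Ring R] [AddCommGroup G] [Module R G]
    [Finite E] [Finite M] {N : Network V E M} (C : N.Code G) : Prop :=
  (∀ e, IsLinearFn R (C.edgeFn e)) ∧ ∀ v m hm, IsLinearFn R (C.decodeFn v m hm)

/-- The network has a linear solution over the left `R`-module `G`. -/
def LinearlySolvable [Finite E] [Finite M] (N : Network V E M)
    (R G : Type*) [Ring R] [AddCommGroup G] [Module R G] : Prop :=
  ∃ C : N.Code G, C.IsLinear R ∧ C.IsSolution

/-- The network has a scalar linear solution over the ring `R`, that is, a linear solution over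
`R` as a left module over itself. -/
def ScalarLinearlySolvable [Finite E] [Finite M] (N : Network V E M)
    (R : Type*) [Ring R] : Prop :=
  N.LinearlySolvable R R

/-- The network has a `k`-dimensional vector linear solution over the ring `R`, that is, a linear
solution over the module of column vectors `R ^ k` over the ring of `k × k` matrices, with
matrix-vector multiplication as the action. -/
def VectorLinearlySolvable [Finite E] [Finite M] (N : Network V E M)
    (R : Type*) [Ring R] (k : ℕ) : Prop :=
  N.LinearlySolvable (Matrix (Fin k) (Fin k) R) (Fin k → R)

end Network

/-!
A scalar linear solution over `R` is a system of identities between elements of `R`: feed the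
code the unit messages and multiply out. The same coefficients therefore solve the network over
*every* left `R`-module `G`, the symbols for messages `x` in `G` being obtained by superposing
the symbols for the unit messages (`ScalarLinearlySolvable.linearlySolvable`).

It remains to find a left `R`-module whose additive group is `GF(p) ^ k`, where `p ^ k` is the
exact power of `p` dividing `|R|`, since any such module turns elements of `R` into `k × k`
matrices over `GF(p)`. The associated graded module
`R / pR ⊕ pR / p²R ⊕ p²R / p³R ⊕ ⋯` has this property: `p` annihilates it, and its cardinality is
`|R|` divided by the cardinality of the stable value of `pʲR`, on which multiplication by `p` is
bijective, so that this cardinality is prime to `p`. It is built one layer at a time in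
`exists_module_card_eq_pow_factorization`.
-/

namespace Network

variable {V E M : Type*} [Finite E] [Finite M] {N : Network V E M}

/-- The coefficients of a scalar linear solution over `R` give a linear solution over every left
`R`-module: the edge symbols for messages `x` are the superposition, over all messages `j`, of
those for the `j`-th unit message, scaled by `x j`. -/
theorem ScalarLinearlySolvable.linearlySolvable {R : Type*} [Ring R]
    (h : N.ScalarLinearlySolvable R) (G : Type*) [AddCommGroup G] [Module R G] :
    N.LinearlySolvable R G := by
  classical
  have := Fintype.ofFinite M
  obtain ⟨C, ⟨hedge, hdec⟩, hC⟩ := h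
  choose c hc using hedge
  choose d hd using hdec
  choose y hy hyd using fun j : M => hC (Pi.single j 1)
  refine ⟨⟨fun e z => ∑ i, c e i • z i, fun v m hm z => ∑ i, d v m hm i • z i⟩,
    ⟨fun e => ⟨c e, fun _ => rfl⟩, fun v m hm => ⟨d v m hm, fun _ => rfl⟩⟩, fun x => ?_⟩
  have hsingle : ∀ m, ∑ j, (Pi.single j (1 : R) : M → R) m • x j = x m := fun m => by
    simp [Pi.single_apply, ite_smul]
  have hinput : ∀ (v : V) (i : N.Inputs v),
      N.inputSymbols x (fun e => ∑ j, y j e • x j) v i =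
        ∑ j, N.inputSymbols (Pi.single j (1 : R)) (y j) v i • x j := by
    rintro v (m | e)
    · exact (hsingle m.1).symm
    · rfl
  have hcomb : ∀ (v : V) (a : N.Inputs v → R),
      ∑ i, a i • N.inputSymbols x (fun e => ∑ j, y j e • x j) v i =
        ∑ j, (∑ i, a i • N.inputSymbols (Pi.single j (1 : R)) (y j) v i) • x j := by
    intro v a
    simp only [hinput, Finset.smul_sum, Finset.sum_smul, smul_assoc]
    exact Finset.sum_comm
  refine ⟨fun e => ∑ j, y j e • x j, fun e => ?_, fun v m hm => ?_⟩
  · refine Eq.trans ?_ (hcomb _ (c e)).symm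
    exact Finset.sum_congr rfl fun j _ => by rw [hy j e, hc]
  · refine (hcomb v (d v m hm)).trans (Eq.trans ?_ (hsingle m))
    exact Finset.sum_congr rfl fun j _ => by rw [← hyd j v m hm, hd]

/-- Linear solutions transfer along an isomorphism of the alphabets that intertwines the two
scalar actions; the map `φ` on scalars need not be multiplicative or additive. -/
theorem LinearlySolvable.of_addEquiv {R S G H : Type*} [Ring R] [AddCommGroup G] [Module R G]
    [Ring S] [AddCommGroup H] [Module S H] (φ : R → S) (f : G ≃+ H)
    (hf : ∀ r g, f (r • g) = φ r • f g) (h : N.LinearlySolvable R G) :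
    N.LinearlySolvable S H := by
  obtain ⟨C, ⟨hedge, hdec⟩, hC⟩ := h
  choose c hc using hedge
  choose d hd using hdec
  refine ⟨⟨fun e z => ∑ i, φ (c e i) • z i, fun v m hm z => ∑ i, φ (d v m hm i) • z i⟩,
    ⟨fun e => ⟨_, fun _ => rfl⟩, fun v m hm => ⟨_, fun _ => rfl⟩⟩, fun x => ?_⟩
  obtain ⟨y, hy, hyd⟩ := hC (f.symm ∘ x)
  have hcomb : ∀ (v : V) (a : N.Inputs v → R),
      ∑ i, φ (a i) • N.inputSymbols x (f ∘ y) v i =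
        f (∑ i, a i • N.inputSymbols (f.symm ∘ x) y v i) := by
    intro v a
    rw [map_sum]
    refine Finset.sum_congr rfl fun i _ => ?_
    rw [hf]
    rcases i with m | e
    · exact congrArg _ (f.apply_symm_apply _).symm
    · rfl
  refine ⟨f ∘ y, fun e => ?_, fun v m hm => ?_⟩
  · refine Eq.trans ?_ (hcomb _ (c e)).symm
    rw [← hc, ← hy e, Function.comp_apply]
  · refine (hcomb v (d v m hm)).trans ?_
    rw [← hd, hyd, Function.comp_apply, f.apply_symm_apply]

/-- A left `R`-module of cardinality `p ^ k` annihilated by `p` is `GF(p) ^ k` with `R` acting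
through `k × k` matrices. -/
theorem LinearlySolvable.vectorLinearlySolvable {R G : Type*} [Ring R] [AddCommGroup G]
    [Module R G] {p k : ℕ} [Fact p.Prime] (hG : ∀ g : G, p • g = 0) (hcard : Nat.card G = p ^ k)
    (h : N.LinearlySolvable R G) : N.VectorLinearlySolvable (ZMod p) k := by
  have : Module (ZMod p) G := AddCommGroup.zmodModule hG
  have hp : p.Prime := Fact.out
  have : Finite G := Nat.finite_of_card_ne_zero (hcard ▸ pow_ne_zero k hp.ne_zero)
  have : Module.Finite (ZMod p) G := Module.Finite.of_finite
  have hrank : Module.finrank (ZMod p) G = k :=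
    Nat.pow_right_injective hp.two_le ((FiniteField.pow_finrank_eq_natCard p G).trans hcard)
  let f : G ≃ₗ[ZMod p] (Fin k → ZMod p) :=
    LinearEquiv.ofFinrankEq G (Fin k → ZMod p) (by rw [hrank, Module.finrank_fin_fun])
  let L : R → G →ₗ[ZMod p] G := fun r => (DistribSMul.toAddMonoidHom G r).toZModLinearMap p
  refine h.of_addEquiv (fun r => LinearMap.toMatrix' (f.conj (L r))) f.toAddEquiv fun r g => ?_
  change f (r • g) = (LinearMap.toMatrix' (f.conj (L r))).mulVec (f g)
  rw [LinearMap.toMatrix'_mulVec, LinearEquiv.conj_apply_apply, LinearEquiv.symm_apply_apply]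
  rfl

end Network

/-- The module `G` is the associated graded module of `X` for the filtration by the `pʲX`,
obtained by adjoining `X / pX` to the one constructed from the smaller module `pX`, until
`pX = X`. -/
theorem exists_module_card_eq_pow_factorization.{u} {R : Type*} [Ring R] {p : ℕ}
    [Fact p.Prime] (X : Type u) [AddCommGroup X] [Module R X] [Finite X] :
    ∃ (G : Type u) (_ : AddCommGroup G) (_ : Module R G),
      (∀ g : G, p • g = 0) ∧ Nat.card G = p ^ (Nat.card X).factorization p := by
  have hp : p.Prime := Fact.out
  induction hn : Nat.card X using Nat.strong_induction_on generalizing X with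
  | _ n ih =>
  subst hn
  let f : Module.End R X := (p : Module.End R X)
  have hf : ∀ x, f x = p • x := fun x => Module.End.natCast_apply p x
  by_cases htop : LinearMap.range f = ⊤
  · -- Multiplication by `p` is bijective, so by Cauchy's theorem `p` does not divide `|X|`.
    have hinj : Function.Injective f :=
      Finite.injective_iff_surjective.2 (LinearMap.range_eq_top.1 htop)
    have hdvd : ¬ p ∣ Nat.card X := fun hd => by
      obtain ⟨x, hx⟩ := exists_prime_addOrderOf_dvd_card' p hd
      have hx0 : x = 0 := hinj (by rw [hf, map_zero, ← hx, addOrderOf_nsmul_eq_zero])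
      rw [hx0, addOrderOf_zero] at hx
      exact hp.one_lt.ne hx
    exact ⟨PUnit, inferInstance, inferInstance, fun _ => rfl, by
      rw [Nat.factorization_eq_zero_of_not_dvd hdvd, Nat.card_unique, pow_zero]⟩
  · have hlt : Nat.card (LinearMap.range f) < Nat.card X := by
      refine lt_of_le_of_ne (Finite.card_subtype_le _) fun heq => htop ?_
      exact Submodule.toAddSubgroup_injective
        (AddSubgroup.eq_top_of_card_eq (LinearMap.range f).toAddSubgroup heq)
    obtain ⟨G, _, _, hG, hcard⟩ := ih _ hlt (LinearMap.range f) rfl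
    have hQ : ∀ q : X ⧸ LinearMap.range f, p • q = 0 := fun q => by
      obtain ⟨x, rfl⟩ := Submodule.mkQ_surjective _ q
      rw [← map_nsmul, ← hf]
      exact (Submodule.Quotient.mk_eq_zero _).2 ⟨x, rfl⟩
    have : Finite (X ⧸ LinearMap.range f) := .of_surjective _ (Submodule.mkQ_surjective _)
    have : Module (ZMod p) (X ⧸ LinearMap.range f) := AddCommGroup.zmodModule hQ
    have hQcard := FiniteField.pow_finrank_eq_natCard p (X ⧸ LinearMap.range f)
    refine ⟨G × (X ⧸ LinearMap.range f), inferInstance, inferInstance,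
      fun g => Prod.ext (hG g.1) (hQ g.2), ?_⟩
    rw [Nat.card_prod, hcard, Submodule.card_eq_card_quotient_mul_card (LinearMap.range f), ← hQcard,
      Nat.factorization_mul Nat.card_pos.ne' (pow_ne_zero _ hp.ne_zero), Finsupp.add_apply,
      hp.factorization_pow, Finsupp.single_eq_same, pow_add]

/-- `ZMod q` with `q` prime is the field `GF(q)`.  The ring `R` need not be commutative. -/
theorem theorem4p15 {V E M : Type*} [Finite V] [Finite E] [Finite M] (N : Network V E M)
    (m t : ℕ) (p k : Fin t → ℕ) (hp : ∀ i, (p i).Prime) (hinj : Function.Injective p)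
    (hk : ∀ i, 0 < k i) (hm : m = ∏ i, p i ^ k i)
    (R : Type*) [Ring R] (hR : Nat.card R = m) (hN : N.ScalarLinearlySolvable R) :
    ∀ i, k i ≤ 6 → N.VectorLinearlySolvable (ZMod (p i)) (k i) := by
  intro i _
  have : Fact (p i).Prime := ⟨hp i⟩
  have hne : ∀ j ∈ Finset.univ, p j ^ k j ≠ 0 := fun j _ => pow_ne_zero _ (hp j).ne_zero
  have : Finite R :=
    Nat.finite_of_card_ne_zero (by rw [hR, hm]; exact Finset.prod_ne_zero_iff.2 hne)
  have hfac : (Nat.card R).factorization (p i) = k i := by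
    rw [hR, hm, Nat.factorization_prod hne, Finsupp.finsetSum_apply,
      Finset.sum_eq_single_of_mem i (Finset.mem_univ i), (hp i).factorization_pow,
      Finsupp.single_eq_same]
    intro j _ hji
    rw [(hp j).factorization_pow, Finsupp.single_eq_of_ne (hinj.ne hji.symm)]
  obtain ⟨G, _, _, hG, hcard⟩ := exists_module_card_eq_pow_factorization (R := R) (p := p i) R
  exact (hN.linearlySolvable G).vectorLinearlySolvable hG (hfac ▸ hcard)
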